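/- Let $\mathbb F$ be a field of prime characteristic $p$, and let $L$ be a finite-dimensional solvable restricted Lie algebra over $\mathbb F$, with $p$-mapping $x\mapsto x^{[p]}$. Let $u(L)$ be its restricted universal enveloping algebra, i.e. the quotient of the universal enveloping algebra $U(L)$ by the two-sided ideal generated by the elements $x^p-x^{[p]}$ with $x\in L$, and let $J$ be the Jacobson radical of $u(L)$. Let $P_L(\mathbb F)$ be the projective cover of the trivial one-dimensional $u(L)$-module $\mathbb F$, i.e. a projective $u(L)$-module together with an epimorphism $\pi:P_L(\mathbb F)\to\mathbb F$ whose kernel is contained in $J\,P_L(\mathbb F)$. The second Loewy layer of $P_L(\mathbb F)$ is the $u(L)$-module $J\,P_L(\mathbb F)/J^2P_L(\mathbb F)$. Let $0=L_0\subset L_1\subset\cdots\subset L_n=L$ be a chief series of the Lie algebra $L$, i.e. a chain of ideals of $L$ such that each $L_j/L_{j-1}$ is a minimal non-zero ideal of $L/L_{j-1}$. The chief factor $S=L_j/L_{j-1}$ is a $u(L)$-module through the adjoint action. It is called split if the exact sequence $0\to L_j/L_{j-1}\to L/L_{j-1}\to L/L_j\to 0$ splits in the category of Lie algebras, and non-trivial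 if $L$ does not act trivially on it. Then every non-trivial split chief factor $S$ of $L$ is isomorphic, as a $u(L)$-module, to a direct summand of the second Loewy layer of $P_L(\mathbb F)$. In particular, every split chief factor of $L$, trivial or not, is a composition factor of the $u(L)$-module $P_L(\mathbb F)$. -/

import Mathlib

open scoped Polynomial

/-! ### Restricted Lie algebras -/

/-- The term `s_i(x, y)` of Jacobson's formula: `i • s_i(x, y)` is the coefficient of `X ^ (i - 1)`
in `(ad (X x + y)) ^ (p - 1) (x)`, computed in `L[X]` for an indeterminate `X`. The operator
`(X ad x + ad y) ^ (p - 1)` is taken in the polynomial ring over the endomorphism ring of `L`. -/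
noncomputable def jacobsonTerm (p : ℕ) (F : Type*) {L : Type*} [Field F] [LieRing L]
    [LieAlgebra F L] (i : ℕ) (x y : L) : L :=
  (i : F)⁻¹ • (((Polynomial.X : (Module.End F L)[X]) * Polynomial.C (LieAlgebra.ad F L x) +
    Polynomial.C (LieAlgebra.ad F L y)) ^ (p - 1)).coeff (i - 1) x

/-- A restricted Lie algebra over a field `F` of characteristic `p`: a Lie algebra with a
`p`-mapping `x ↦ x^[p]`, in the sense of Jacobson. -/
class RestrictedLieAlgebra (p : ℕ) (F L : Type*) [Field F] [LieRing L] [LieAlgebra F L] where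
  /-- the `p`-mapping `x ↦ x^[p]` -/
  pMap : L → L
  ad_pMap : ∀ x : L, LieAlgebra.ad F L (pMap x) = LieAlgebra.ad F L x ^ p
  pMap_smul : ∀ (c : F) (x : L), pMap (c • x) = c ^ p • pMap x
  pMap_add : ∀ x y : L,
    pMap (x + y) = pMap x + pMap y + ∑ i ∈ Finset.Icc 1 (p - 1), jacobsonTerm p F i x y

/-- The relations `x ^ p = x^[p]`, `x ∈ L`, in the universal enveloping algebra of `L`. -/
inductive RestrictedEnvelopingRel (p : ℕ) (F L : Type*) [Field F] [LieRing L] [LieAlgebra F L]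
    [RestrictedLieAlgebra p F L] :
    UniversalEnvelopingAlgebra F L → UniversalEnvelopingAlgebra F L → Prop
  | pow (x : L) : RestrictedEnvelopingRel p F L (UniversalEnvelopingAlgebra.ι F x ^ p)
      (UniversalEnvelopingAlgebra.ι F (RestrictedLieAlgebra.pMap p F x))

/-- The restricted universal enveloping algebra `u(L)`: the quotient of the universal enveloping
algebra by the two-sided ideal generated by the elements `x ^ p - x^[p]`, `x ∈ L`. -/
def RestrictedEnvelopingAlgebra (p : ℕ) (F L : Type*) [Field F] [LieRing L] [LieAlgebra F L]
    [RestrictedLieAlgebra p F L] : Type _ :=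
  RingQuot (RestrictedEnvelopingRel p F L)

namespace RestrictedEnvelopingAlgebra

variable (p : ℕ) (F L : Type*) [Field F] [LieRing L] [LieAlgebra F L]
  [RestrictedLieAlgebra p F L]

noncomputable instance instRing : Ring (RestrictedEnvelopingAlgebra p F L) :=
  inferInstanceAs (Ring (RingQuot (RestrictedEnvelopingRel p F L)))

noncomputable instance instAlgebra : Algebra F (RestrictedEnvelopingAlgebra p F L) :=
  inferInstanceAs (Algebra F (RingQuot (RestrictedEnvelopingRel p F L)))

/-- The quotient map from the universal enveloping algebra onto `u(L)`. -/
noncomputable def mkAlgHom :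
    UniversalEnvelopingAlgebra F L →ₐ[F] RestrictedEnvelopingAlgebra p F L :=
  RingQuot.mkAlgHom F (RestrictedEnvelopingRel p F L)

end RestrictedEnvelopingAlgebra

/-! ### Restricted modules as `u(L)`-modules -/

/-- An `L`-module is restricted if `x^[p]` acts as the `p`-th power of the action of `x`. -/
class IsRestrictedModule (p : ℕ) (F L M : Type*) [Field F] [LieRing L] [LieAlgebra F L]
    [RestrictedLieAlgebra p F L] [AddCommGroup M] [Module F M] [LieRingModule L M]
    [LieModule F L M] : Prop where
  toEnd_pMap : ∀ x : L, LieModule.toEnd F L M (RestrictedLieAlgebra.pMap p F x) =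
    LieModule.toEnd F L M x ^ p

section UModule

variable (p : ℕ) (F L M : Type*) [Field F] [LieRing L] [LieAlgebra F L]
  [RestrictedLieAlgebra p F L] [AddCommGroup M] [Module F M] [LieRingModule L M]
  [LieModule F L M]

/-- The representation of `u(L)` on a restricted `L`-module that extends the action of `L`. -/
noncomputable def restrictedRep [IsRestrictedModule p F L M] :
    RestrictedEnvelopingAlgebra p F L →ₐ[F] Module.End F M :=
  RingQuot.liftAlgHom F ⟨UniversalEnvelopingAlgebra.lift F (LieModule.toEnd F L M), by
    rintro _ _ ⟨x⟩
    rw [map_pow, UniversalEnvelopingAlgebra.lift_ι_apply, UniversalEnvelopingAlgebra.lift_ι_apply,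
      IsRestrictedModule.toEnd_pMap]⟩

theorem restrictedRep_ι [IsRestrictedModule p F L M] (x : L) :
    restrictedRep p F L M (RestrictedEnvelopingAlgebra.mkAlgHom p F L
      (UniversalEnvelopingAlgebra.ι F x)) = LieModule.toEnd F L M x := by
  unfold restrictedRep RestrictedEnvelopingAlgebra.mkAlgHom
  erw [RingQuot.liftAlgHom_mkAlgHom_apply]
  rw [UniversalEnvelopingAlgebra.lift_ι_apply]

/-- A restricted `L`-module `M`, regarded as a `u(L)`-module. -/
@[nolint unusedArguments]
def UModule (_p : ℕ) (_F _L M : Type*) : Type _ := M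

instance UModule.instAddCommGroup : AddCommGroup (UModule p F L M) :=
  inferInstanceAs (AddCommGroup M)

noncomputable instance UModule.instModule [IsRestrictedModule p F L M] :
    Module (RestrictedEnvelopingAlgebra p F L) (UModule p F L M) :=
  Module.compHom M (restrictedRep p F L M).toRingHom

end UModule

/-- The trivial one-dimensional `L`-module is restricted. -/
instance trivial_isRestrictedModule (p : ℕ) [Fact p.Prime] (F L : Type*) [Field F] [LieRing L]
    [LieAlgebra F L] [RestrictedLieAlgebra p F L] :
    IsRestrictedModule p F L (TrivialLieModule F L F) where
  toEnd_pMap x := by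
    have h (y : L) : LieModule.toEnd F L (TrivialLieModule F L F) y = 0 :=
      LinearMap.ext fun m => LieModule.IsTrivial.trivial y m
    rw [h, h, zero_pow (Fact.out : p.Prime).ne_zero]

/-! ### Chief series and split chief factors -/

section Chief

variable {F L : Type*} [Field F] [LieRing L] [LieAlgebra F L]

/-- The quotient map `L → L / I` as a homomorphism of Lie algebras. -/
def lieQuotMk (I : LieIdeal F L) : L →ₗ⁅F⁆ L ⧸ I :=
  { I.toSubmodule.mkQ with map_lie' := fun {_ _} => rfl }

/-- For ideals `I ≤ J` of `L`, the natural map `L / I → L / J` as a homomorphism of Lie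
algebras. -/
def lieQuotFactor {I J : LieIdeal F L} (h : I ≤ J) : (L ⧸ I) →ₗ⁅F⁆ (L ⧸ J) :=
  { Submodule.factor (show I.toSubmodule ≤ J.toSubmodule from h) with
    map_lie' := by
      intro x y
      obtain ⟨x, rfl⟩ := Submodule.Quotient.mk_surjective _ x
      obtain ⟨y, rfl⟩ := Submodule.Quotient.mk_surjective _ y
      rfl }

/-- A chief series `0 = I 0 ⊂ I 1 ⊂ ⋯ ⊂ I n = L` of a Lie algebra `L`: a chain of ideals such that
each `I (j + 1) / I j` is a minimal non-zero ideal of `L / I j`. -/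
structure IsChiefSeries {n : ℕ} (I : Fin (n + 1) → LieIdeal F L) : Prop where
  zero : I 0 = ⊥
  last : I (Fin.last n) = ⊤
  le (j : Fin n) : I j.castSucc ≤ I j.succ
  minimal (j : Fin n) : IsAtom (LieIdeal.map (lieQuotMk (I j.castSucc)) (I j.succ))

/-- The factor `J / I` of two ideals `I ≤ J` of `L`, as an `L`-module with the action induced by
the adjoint action. -/
abbrev LieFactor (I J : LieIdeal F L) : Type _ :=
  ↥J ⧸ LieSubmodule.comap (LieSubmodule.incl J) I

/-- For ideals `I ≤ J` of `L`, the exact sequence `0 → J / I → L / I → L / J → 0` splits in the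
category of Lie algebras. -/
def IsSplitFactor {I J : LieIdeal F L} (h : I ≤ J) : Prop :=
  ∃ σ : (L ⧸ J) →ₗ⁅F⁆ (L ⧸ I), ∀ x : L ⧸ J, lieQuotFactor h (σ x) = x

/-- Factors of ideals of a restricted Lie algebra are restricted modules. -/
instance lieFactor_isRestrictedModule (p : ℕ) [RestrictedLieAlgebra p F L] (I J : LieIdeal F L) :
    IsRestrictedModule p F L (LieFactor I J) where
  toEnd_pMap x := by
    have key (k : ℕ) (m : J) : (LieModule.toEnd F L (LieFactor I J) x ^ k)
        (LieSubmodule.Quotient.mk m) =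
        LieSubmodule.Quotient.mk ((LieModule.toEnd F L J x ^ k) m) := by
      induction k with
      | zero => rfl
      | succ k ih => rw [pow_succ', pow_succ', Module.End.mul_apply, ih]; rfl
    have key' (k : ℕ) (m : J) : (((LieModule.toEnd F L J x ^ k) m : J) : L) =
        (LieAlgebra.ad F L x ^ k) (m : L) := by
      induction k with
      | zero => rfl
      | succ k ih =>
        rw [pow_succ', pow_succ', Module.End.mul_apply, Module.End.mul_apply, ← ih]; rfl
    ext m
    obtain ⟨m, rfl⟩ := Submodule.Quotient.mk_surjective _ m
    refine Eq.trans ?_ (key p m).symm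
    refine congrArg LieSubmodule.Quotient.mk (Subtype.ext ?_)
    rw [key', ← RestrictedLieAlgebra.ad_pMap]
    rfl

end Chief

/-! ### Loewy layers, projective covers, direct summands and composition factors -/

section Modules

variable (A : Type*) [Ring A] (M : Type*) [AddCommGroup M] [Module A M]

/-- The submodule `Jac(A)^k M` of an `A`-module `M`. -/
def jacPow (k : ℕ) : Submodule A M :=
  (Ring.jacobson A ^ k) • (⊤ : Submodule A M)

/-- The `n`-th Loewy layer `Jac(A)^(n-1) M / Jac(A)^n M` of an `A`-module `M`, for `n ≥ 1`. -/
abbrev LoewyLayer (n : ℕ) : Type _ :=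
  ↥(jacPow A M (n - 1)) ⧸ (jacPow A M n).comap (jacPow A M (n - 1)).subtype

variable {A M}

/-- `π : P → M` is a projective cover of `M`: the module `P` is projective and `π` is an
epimorphism with kernel contained in `Jac(A) P`. -/
structure IsProjectiveCover {P : Type*} [AddCommGroup P] [Module A P] (π : P →ₗ[A] M) : Prop where
  projective : Module.Projective A P
  surjective : Function.Surjective π
  ker_le : LinearMap.ker π ≤ Ring.jacobson A • (⊤ : Submodule A P)

variable (A M)

/-- The `A`-module `S` is (isomorphic to) a direct summand of the `A`-module `M`. -/
def IsDirectSummand (S : Type*) [AddCommGroup S] [Module A S] : Prop :=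
  ∃ N N' : Submodule A M, IsCompl N N' ∧ Nonempty (S ≃ₗ[A] N)

/-- The `A`-module `S` is (isomorphic to) a composition factor of the `A`-module `M`: it is
isomorphic to a factor of a composition series from `0` to `M`. -/
def IsCompositionFactor (S : Type*) [AddCommGroup S] [Module A S] : Prop :=
  ∃ s : CompositionSeries (Submodule A M), s.head = ⊥ ∧ s.last = ⊤ ∧
    ∃ i : Fin s.length,
      Nonempty (S ≃ₗ[A] (↥(s i.succ) ⧸ (s i.castSucc).comap (s i.succ).subtype))

end Modules

/-! Let `S = J/I` be a split chief factor. Since `L` is solvable, `S` is abelian. The projection of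
`L/I` onto `S` along the complement is therefore a derivation `D : L → S`. It is outer: on `J` it is
the quotient map, while inner derivations vanish there (`exists_outer_lieDerivation`).

Suppose `S` is non-trivial. Then it has no invariants, which forces `D(x^[p]) = x^(p-1) D(x)`
(`cocycleRep_pMap`). Hence the extension of `F` by `S` that `D` defines on `S × F` is a
`u(L)`-module, and it does not split because `D` is outer. Lifting `π` to this extension maps `Jac
P` onto `S` and kills `Jac² P` (`IsProjectiveCover.exists_surjective`). The second Loewy layer is
semisimple, so its quotient `S` is a summand. A trivial `S` is a quotient of `F`, hence of `P`.

The module theory needs `u(L)` to be artinian. For this the spanning half of the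
Poincaré–Birkhoff–Witt theorem is enough (`wordSpan_eq_top`). -/

/-! ### Simple subquotients as composition factors. -/

section CompositionFactors

variable {A M S : Type*} [Ring A] [AddCommGroup M] [Module A M] [AddCommGroup S] [Module A S]

theorem exists_compositionSeries_le [IsNoetherian A M] [IsArtinian A M] (N : Submodule A M) :
    ∃ s : CompositionSeries (Submodule A M), s.head = ⊥ ∧ s.last = N := by
  induction N using WellFoundedLT.induction with
  | _ N ih =>
    rcases (bot_le : ⊥ ≤ N).eq_or_lt with rfl | h
    · exact ⟨RelSeries.singleton _ ⊥, rfl, rfl⟩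
    · obtain ⟨x, -, hx⟩ := exists_le_covBy_of_lt h
      obtain ⟨s, hs, hs'⟩ := ih x hx.lt
      exact ⟨s.snoc N (by rw [hs']; exact hx), by simpa using hs, by simp⟩

/-- Descend from `N` through maximal submodules containing `N₂`; at `N₂` continue with `N₁` and any
series below it. -/
theorem exists_compositionSeries_step [IsNoetherian A M] [IsArtinian A M] {N₁ N₂ : Submodule A M}
    (h : N₁ ⋖ N₂) (N : Submodule A M) (hN : N₂ ≤ N) :
    ∃ s : CompositionSeries (Submodule A M), s.head = ⊥ ∧ s.last = N ∧
      ∃ i : Fin s.length, s i.castSucc = N₁ ∧ s i.succ = N₂ := by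
  induction N using WellFoundedLT.induction with
  | _ N ih =>
    rcases hN.eq_or_lt with rfl | hlt
    · obtain ⟨s, hs, hs'⟩ := exists_compositionSeries_le N₁
      refine ⟨s.snoc N₂ (by rw [hs']; exact h), by simpa using hs, by simp,
        Fin.last s.length, ?_, ?_⟩
      · exact (RelSeries.snoc_castSucc _ _ _ _).trans hs'
      · exact RelSeries.last_snoc' _ _ _
    · obtain ⟨x, hx, hx'⟩ := exists_le_covBy_of_lt hlt
      obtain ⟨s, hs, hs', i, hi, hi'⟩ := ih x hx'.lt hx
      refine ⟨s.snoc N (by rw [hs']; exact hx'), by simpa using hs, by simp, i.castSucc, ?_, ?_⟩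
      · exact (RelSeries.snoc_castSucc _ _ _ _).trans hi
      · exact (RelSeries.snoc_castSucc s N _ i.succ).trans hi'

theorem isCompositionFactor_of_surjective [IsNoetherian A M] [IsArtinian A M] [IsSimpleModule A S]
    {N : Submodule A M} (f : N →ₗ[A] S) (hf : Function.Surjective f) :
    IsCompositionFactor A M S := by
  have hcomap : (Submodule.map N.subtype (LinearMap.ker f)).comap N.subtype = LinearMap.ker f :=
    Submodule.comap_map_eq_of_injective N.injective_subtype _
  let e : S ≃ₗ[A] N ⧸ (Submodule.map N.subtype (LinearMap.ker f)).comap N.subtype :=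
    (Submodule.quotEquivOfEq _ _ hcomap ≪≫ₗ f.quotKerEquivOfSurjective hf).symm
  have hcov : Submodule.map N.subtype (LinearMap.ker f) ⋖ N :=
    (covBy_iff_quot_is_simple (Submodule.map_subtype_le _ _)).mpr (IsSimpleModule.congr e.symm)
  obtain ⟨s, hs, hs', i, hi, hi'⟩ := exists_compositionSeries_step hcov ⊤ le_top
  refine ⟨s, hs, hs', i, ?_⟩
  rw [hi, hi']
  exact ⟨e⟩

end CompositionFactors

/-! ### Nakayama's lemma, projective covers and the second Loewy layer. -/

section ProjectiveCover

variable {A M P : Type*} [Ring A] [AddCommGroup M] [Module A M] [AddCommGroup P] [Module A P]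

/-- Such an `M` is a module over the semisimple ring `A / Jac(A)`, with the same submodules. -/
theorem isSemisimpleModule_of_jacobson_smul_eq_zero [IsSemiprimaryRing A]
    (h : ∀ r ∈ Ring.jacobson A, ∀ m : M, r • m = 0) : IsSemisimpleModule A M := by
  have ht : Module.IsTorsionBySet A M (Ring.jacobson A) := fun m r => h r r.2 m
  let _ := ht.module
  have : IsSemisimpleRing (A ⧸ Ring.jacobson A) := IsSemiprimaryRing.isSemisimpleRing
  exact (ht.semilinearMap.isSemisimpleModule_iff_of_bijective Function.bijective_id).2
    inferInstance

instance loewyLayer_isSemisimpleModule [IsSemiprimaryRing A] :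
    IsSemisimpleModule A (LoewyLayer A M 2) := by
  refine isSemisimpleModule_of_jacobson_smul_eq_zero fun r hr m => ?_
  obtain ⟨⟨m, hm⟩, rfl⟩ := Submodule.Quotient.mk_surjective _ m
  rw [← Submodule.Quotient.mk_smul, Submodule.Quotient.mk_eq_zero]
  change r • m ∈ jacPow A M 2
  unfold jacPow at hm ⊢
  rw [Submodule.pow_succ, Submodule.mul_smul, Submodule.pow_one]
  exact Submodule.smul_mem_smul hr (by simpa [Submodule.pow_one] using hm)

/-- A form of Nakayama's lemma, for a nilpotent Jacobson radical. -/
theorem eq_top_of_sup_jacobson_smul_eq_top [IsSemiprimaryRing A] {N : Submodule A P}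
    (h : N ⊔ Ring.jacobson A • (⊤ : Submodule A P) = ⊤) : N = ⊤ := by
  have key (k : ℕ) : N ⊔ (Ring.jacobson A ^ k) • (⊤ : Submodule A P) = ⊤ := by
    induction k with
    | zero => rw [Submodule.pow_zero, Ideal.one_eq_top, Submodule.top_smul, sup_top_eq]
    | succ k ih =>
      refine eq_top_iff.mpr (le_trans (ih.symm.trans ?_).le (sup_le_sup_right
        (sup_le le_rfl (Submodule.smul_le_right : (Ring.jacobson A ^ k) • N ≤ N)) _))
      -- With `P = N + Jac P`, the term `Jac^k P` becomes `Jac^k N + Jac^(k+1) P`, and `Jac^k N` is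
      -- absorbed by `N`.
      conv_lhs => rw [← h]
      rw [Submodule.smul_sup, Submodule.pow_succ, Submodule.mul_smul, sup_assoc]
  obtain ⟨k, hk⟩ := IsSemiprimaryRing.isNilpotent (R := A)
  simpa [hk] using key k

/-- Lifts of generators of `M` generate `P` modulo `ker π ≤ Jac P`, so Nakayama applies. -/
theorem IsProjectiveCover.finite [IsSemiprimaryRing A] [Module.Finite A M] {π : P →ₗ[A] M}
    (hπ : IsProjectiveCover π) : Module.Finite A P := by
  obtain ⟨s, hs⟩ := Module.Finite.fg_top (R := A) (M := M)
  choose g hg using hπ.surjective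
  refine ⟨Submodule.fg_def.mpr ⟨g '' s, s.finite_toSet.image g, ?_⟩⟩
  refine eq_top_of_sup_jacobson_smul_eq_top (top_le_iff.mp ?_)
  refine le_trans ?_ (sup_le_sup_left hπ.ker_le _)
  rw [← LinearMap.map_le_map_iff, Submodule.map_span, ← Set.image_comp,
    show π ∘ g = id from funext hg, Set.image_id, hs]
  exact le_top

theorem isDirectSummand_of_surjective {S : Type*} [AddCommGroup S] [Module A S]
    [IsSemisimpleModule A M] (f : M →ₗ[A] S) (hf : Function.Surjective f) :
    IsDirectSummand A M S := by
  obtain ⟨N, hN⟩ := exists_isCompl (LinearMap.ker f)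
  exact ⟨N, LinearMap.ker f, hN.symm,
    ⟨(f.quotKerEquivOfSurjective hf).symm ≪≫ₗ Submodule.quotientEquivOfIsCompl _ _ hN⟩⟩

/-- If `S` is the kernel of a non-split epimorphism onto `M`, then the radical of the projective
cover of `M` maps onto `S`. -/
theorem IsProjectiveCover.exists_surjective {S E : Type*} [AddCommGroup S] [Module A S]
    [AddCommGroup E] [Module A E] [IsSimpleModule A S] [IsSemisimpleModule A M] {π : P →ₗ[A] M}
    (hπ : IsProjectiveCover π) (q : E →ₗ[A] M) (hq : Function.Surjective q)
    (e : S ≃ₗ[A] LinearMap.ker q) (hns : ¬ ∃ N, IsCompl N (LinearMap.ker q)) :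
    ∃ f : LoewyLayer A P 2 →ₗ[A] S, Function.Surjective f := by
  have := hπ.projective
  obtain ⟨φ, hφ⟩ := Module.projective_lifting_property q π hq
  have hφ' (x : P) : q (φ x) = π x := LinearMap.congr_fun hφ x
  have hatom : IsAtom (LinearMap.ker q) :=
    isSimpleModule_iff_isAtom.mp (IsSimpleModule.congr e.symm)
  have hsup : LinearMap.range φ ⊔ LinearMap.ker q = ⊤ := by
    rw [← LinearMap.map_eq_top_iff (LinearMap.range_eq_top.mpr hq), ← LinearMap.range_comp, hφ]
    exact LinearMap.range_eq_top.mpr hπ.surjective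
  -- The kernel is simple: if it were not inside the range of `φ`, it would meet it in zero and the
  -- range would be a complement.
  have hle : LinearMap.ker q ≤ LinearMap.range φ := by
    by_contra hcon
    refine hns ⟨_, ?_, codisjoint_iff.mpr hsup⟩
    exact (hatom.not_le_iff_disjoint.mp hcon).symm
  have hJ : Ring.jacobson A • (⊤ : Submodule A P) ≤ (LinearMap.ker q).comap φ := by
    refine Submodule.smul_le.mpr fun r hr x _ => ?_
    rw [Submodule.mem_comap, LinearMap.mem_ker, hφ', map_smul]
    exact Module.mem_annihilator.mp (IsSemisimpleModule.jacobson_le_annihilator A M hr) _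
  have h1 : jacPow A P (2 - 1) = Ring.jacobson A • ⊤ := by
    unfold jacPow; rw [Nat.add_one_sub_one, Submodule.pow_one]
  have h2 : jacPow A P 2 = Ring.jacobson A • Ring.jacobson A • ⊤ := by
    unfold jacPow; rw [Submodule.pow_succ, Submodule.pow_one, Submodule.mul_smul]
  let g : jacPow A P (2 - 1) →ₗ[A] S := e.symm.toLinearMap ∘ₗ
    LinearMap.codRestrict (LinearMap.ker q) (φ ∘ₗ (jacPow A P (2 - 1)).subtype)
      fun x => hJ (h1.le x.2)
  have hg (x : jacPow A P (2 - 1)) : ((e (g x) : LinearMap.ker q) : E) = φ x := by simp [g]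
  have hgs : Function.Surjective g := by
    intro s
    obtain ⟨x, hx⟩ := hle (e s).2
    -- Any preimage under `φ` of an element of `ker q` lies in `ker π`, hence in `Jac P`.
    have hxk : x ∈ LinearMap.ker π := by
      rw [LinearMap.mem_ker, ← hφ', hx]; exact (e s).2
    refine ⟨⟨x, h1.ge (hπ.ker_le hxk)⟩, e.injective (Subtype.ext ?_)⟩
    rw [hg, hx]
  have hgk : (jacPow A P 2).comap (jacPow A P (2 - 1)).subtype ≤ LinearMap.ker g := by
    rw [← Submodule.map_le_map_iff_of_injective (Submodule.injective_subtype _),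
      Submodule.map_comap_eq]
    refine inf_le_right.trans ?_
    rw [h2]
    refine Submodule.smul_le.mpr fun r hr x hx => ?_
    refine ⟨r • ⟨x, h1.ge hx⟩, ?_, rfl⟩
    rw [SetLike.mem_coe, LinearMap.mem_ker, map_smul]
    exact Module.mem_annihilator.mp (IsSemisimpleModule.jacobson_le_annihilator A S hr) _
  refine ⟨Submodule.liftQ _ g hgk, fun s => ?_⟩
  obtain ⟨x, rfl⟩ := hgs s
  exact ⟨Submodule.Quotient.mk x, rfl⟩

end ProjectiveCover

/-! ### Generators and universal property of `u(L)`. -/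

section RestrictedEnvelopingAlgebra

attribute [local instance] LieRing.ofAssociativeRing

/-- By the universal property, the extension of `L → S` to the enveloping algebra, followed by the
inclusion of `S`, is the identity. -/
theorem UniversalEnvelopingAlgebra.adjoin_range_ι (F L : Type*) [Field F] [LieRing L]
    [LieAlgebra F L] :
    Algebra.adjoin F (Set.range (UniversalEnvelopingAlgebra.ι F : L → _)) = ⊤ := by
  set S := Algebra.adjoin F (Set.range (UniversalEnvelopingAlgebra.ι F : L → _)) with hS
  let f : L →ₗ⁅F⁆ S :=
    { toFun := fun x => ⟨UniversalEnvelopingAlgebra.ι F x, Algebra.subset_adjoin ⟨x, rfl⟩⟩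
      map_add' := fun x y => Subtype.ext (map_add _ x y)
      map_smul' := fun c x => Subtype.ext (map_smul _ c x)
      map_lie' := fun {x y} => Subtype.ext (LieHom.map_lie _ x y) }
  have h : S.val.comp (UniversalEnvelopingAlgebra.lift F f) = AlgHom.id F _ := by
    refine UniversalEnvelopingAlgebra.hom_ext F (LieHom.ext fun x => ?_)
    change S.val (UniversalEnvelopingAlgebra.lift F f (UniversalEnvelopingAlgebra.ι F x)) =
      UniversalEnvelopingAlgebra.ι F x
    rw [UniversalEnvelopingAlgebra.lift_ι_apply]
    rfl
  refine eq_top_iff.mpr fun a _ => ?_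
  rw [show a = S.val (UniversalEnvelopingAlgebra.lift F f a) from (AlgHom.congr_fun h a).symm]
  exact Subtype.property _

namespace RestrictedEnvelopingAlgebra

variable (p : ℕ) (F L : Type*) [Field F] [LieRing L] [LieAlgebra F L]
  [RestrictedLieAlgebra p F L]

/-- The canonical map from `L` to `u(L)`. -/
noncomputable def ι : L →ₗ⁅F⁆ RestrictedEnvelopingAlgebra p F L :=
  (mkAlgHom p F L).toLieHom.comp (UniversalEnvelopingAlgebra.ι F)

theorem ι_apply (x : L) : ι p F L x = mkAlgHom p F L (UniversalEnvelopingAlgebra.ι F x) := rfl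

theorem ι_pow (x : L) : ι p F L x ^ p = ι p F L (RestrictedLieAlgebra.pMap p F x) := by
  rw [ι_apply, ι_apply, ← map_pow]
  exact RingQuot.mkAlgHom_rel F (RestrictedEnvelopingRel.pow x)

theorem mkAlgHom_surjective : Function.Surjective (mkAlgHom p F L) :=
  RingQuot.mkAlgHom_surjective F _

theorem adjoin_range_ι : Algebra.adjoin F (Set.range (ι p F L)) = ⊤ := by
  have h : Set.range (ι p F L) =
      mkAlgHom p F L '' Set.range (UniversalEnvelopingAlgebra.ι F : L → _) := by
    rw [← Set.range_comp]; rfl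
  rw [h, ← AlgHom.map_adjoin, UniversalEnvelopingAlgebra.adjoin_range_ι, Algebra.map_top]
  exact (AlgHom.range_eq_top _).mpr (mkAlgHom_surjective p F L)

@[elab_as_elim]
theorem induction {motive : RestrictedEnvelopingAlgebra p F L → Prop}
    (algebraMap : ∀ c, motive (algebraMap F _ c)) (ι : ∀ x, motive (ι p F L x))
    (add : ∀ a b, motive a → motive b → motive (a + b))
    (mul : ∀ a b, motive a → motive b → motive (a * b)) (a : RestrictedEnvelopingAlgebra p F L) :
    motive a := by
  have ha : a ∈ Algebra.adjoin F (Set.range (RestrictedEnvelopingAlgebra.ι p F L)) := by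
    rw [adjoin_range_ι]; trivial
  induction ha using Algebra.adjoin_induction with
  | mem _ h => obtain ⟨x, rfl⟩ := h; exact ι x
  | algebraMap c => exact algebraMap c
  | add a b _ _ ha hb => exact add a b ha hb
  | mul a b _ _ ha hb => exact mul a b ha hb

/-- A Lie algebra homomorphism into an associative algebra that respects the `p`-mapping extends
to `u(L)`. -/
noncomputable def lift {p : ℕ} {F L : Type*} [Field F] [LieRing L] [LieAlgebra F L]
    [RestrictedLieAlgebra p F L] {B : Type*} [Ring B] [Algebra F B] (f : L →ₗ⁅F⁆ B)
    (hf : ∀ x, f (RestrictedLieAlgebra.pMap p F x) = f x ^ p) :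
    RestrictedEnvelopingAlgebra p F L →ₐ[F] B :=
  RingQuot.liftAlgHom F ⟨UniversalEnvelopingAlgebra.lift F f, by
    rintro _ _ ⟨x⟩
    rw [map_pow, UniversalEnvelopingAlgebra.lift_ι_apply, UniversalEnvelopingAlgebra.lift_ι_apply,
      hf]⟩

theorem lift_ι {p : ℕ} {F L : Type*} [Field F] [LieRing L] [LieAlgebra F L]
    [RestrictedLieAlgebra p F L] {B : Type*} [Ring B] [Algebra F B] (f : L →ₗ⁅F⁆ B)
    (hf : ∀ x, f (RestrictedLieAlgebra.pMap p F x) = f x ^ p) (x : L) :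
    lift f hf (ι p F L x) = f x := by
  rw [ι_apply]
  unfold lift mkAlgHom
  erw [RingQuot.liftAlgHom_mkAlgHom_apply]
  rw [UniversalEnvelopingAlgebra.lift_ι_apply]

/-- As `L` generates `u(L)`, equivariance has to be checked on `L` only. -/
theorem map_rep_apply {p : ℕ} {F L : Type*} [Field F] [LieRing L] [LieAlgebra F L]
    [RestrictedLieAlgebra p F L] {M N : Type*} [AddCommGroup M] [Module F M] [AddCommGroup N]
    [Module F N] {ρ : RestrictedEnvelopingAlgebra p F L →ₐ[F] Module.End F M}
    {τ : RestrictedEnvelopingAlgebra p F L →ₐ[F] Module.End F N} (f : M →ₗ[F] N)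
    (h : ∀ x m, f (ρ (ι p F L x) m) = τ (ι p F L x) (f m))
    (a : RestrictedEnvelopingAlgebra p F L) (m : M) : f (ρ a m) = τ a (f m) := by
  induction a using RestrictedEnvelopingAlgebra.induction generalizing m with
  | algebraMap c => simp [AlgHom.commutes, Module.algebraMap_end_apply]
  | ι x => exact h x m
  | add a b ha hb => simp [ha, hb]
  | mul a b ha hb => simp [ha, hb]

/-! ### Finite dimension of `u(L)`. -/

section FiniteDimensional

variable {F L} {I : Type*} (b : Module.Basis I F L)

/-- The span of the products of at most `k` elements of a basis of `L`. -/
noncomputable def wordSpan (k : ℕ) : Submodule F (RestrictedEnvelopingAlgebra p F L) :=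
  Submodule.span F ((fun l : List I => (l.map fun i => ι p F L (b i)).prod) ''
    {l | l.length ≤ k})

variable {p b}

theorem prod_mem_wordSpan {k : ℕ} {l : List I} (h : l.length ≤ k) :
    (l.map fun i => ι p F L (b i)).prod ∈ wordSpan p b k :=
  Submodule.subset_span ⟨l, h, rfl⟩

theorem wordSpan_mono {k m : ℕ} (h : k ≤ m) : wordSpan p b k ≤ wordSpan p b m :=
  Submodule.span_mono (Set.image_mono fun _ hl => le_trans hl h)

theorem ι_mul_mem_wordSpan {k : ℕ} (x : L) {a : RestrictedEnvelopingAlgebra p F L}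
    (ha : a ∈ wordSpan p b k) : ι p F L x * a ∈ wordSpan p b (k + 1) := by
  induction b.mem_span x using Submodule.span_induction with
  | mem _ h =>
    obtain ⟨i, rfl⟩ := h
    induction ha using Submodule.span_induction with
    | mem _ h =>
      obtain ⟨l, hl, rfl⟩ := h
      exact prod_mem_wordSpan (l := i :: l) (Nat.succ_le_succ hl)
    | zero => simp
    | add _ _ _ _ h h' => rw [mul_add]; exact add_mem h h'
    | smul c _ _ h => rw [mul_smul_comm]; exact Submodule.smul_mem _ c h
  | zero => simp
  | add _ _ _ _ h h' => rw [map_add, add_mul]; exact add_mem h h'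
  | smul c _ _ h => rw [map_smul, smul_mul_assoc]; exact Submodule.smul_mem _ c h

/-- Swapping two adjacent letters costs their bracket, a single element of `L`, which shortens the
word by one. -/
theorem prod_sub_prod_mem_wordSpan {l l' : List I} (h : l.Perm l') (k : ℕ)
    (hl : l.length = k + 1) :
    (l.map fun i => ι p F L (b i)).prod - (l'.map fun i => ι p F L (b i)).prod ∈
      wordSpan p b k := by
  induction h generalizing k with
  | nil => simp
  | @cons i l l' h ih =>
    cases k with
    | zero =>
      obtain rfl : l = [] := by simpa using hl
      simp [h.nil_eq]
    | succ k =>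
      rw [List.map_cons, List.map_cons, List.prod_cons, List.prod_cons, ← mul_sub]
      exact ι_mul_mem_wordSpan _ (ih k (by simpa using hl))
  | swap i j l =>
    simp only [List.map_cons, List.prod_cons]
    rw [← mul_assoc, ← mul_assoc, ← sub_mul, ← Ring.lie_def, ← LieHom.map_lie]
    obtain ⟨m, rfl⟩ : ∃ m, k = m + 1 := ⟨l.length, by simpa using hl.symm⟩
    exact ι_mul_mem_wordSpan _ (prod_mem_wordSpan (by simpa using hl.le))
  | trans h _ ih ih' =>
    rw [← sub_add_sub_cancel]
    exact add_mem (ih k hl) (ih' k (h.length_eq ▸ hl))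

/-- By pigeonhole some letter `x` occurs at least `p` times. Modulo shorter words, `p` copies of it
can be moved to the front, and `x ^ p = x^[p]` is one element of `L`. -/
theorem prod_mem_wordSpan_of_le_length [Fintype I] (hp : 1 < p) {k : ℕ}
    (hk : Fintype.card I * (p - 1) ≤ k) {l : List I} (hl : l.length = k + 1) :
    (l.map fun i => ι p F L (b i)).prod ∈ wordSpan p b k := by
  classical
  obtain ⟨i, hi⟩ : ∃ i, p ≤ l.count i := by
    by_contra! hcon
    have h := Finset.sum_le_card_nsmul Finset.univ (fun i => l.count i) (p - 1)
      fun i _ => Nat.le_sub_one_of_lt (hcon i)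
    have h' : ∑ i, l.count i = l.length := by
      simpa using Multiset.sum_count_eq_card (s := Finset.univ) (m := (l : Multiset I))
        (by simp)
    rw [h', Finset.card_univ, smul_eq_mul] at h
    lia
  obtain ⟨l', hl'⟩ : ∃ l', l.Perm (List.replicate p i ++ l') := by
    have hi' : p ≤ Multiset.count i (l : Multiset I) := by simpa using hi
    obtain ⟨m, hm⟩ := Multiset.le_iff_exists_add.mp (Multiset.le_count_iff_replicate_le.mp hi')
    obtain ⟨l', rfl⟩ := Quotient.exists_rep m
    exact ⟨l', Multiset.coe_eq_coe.mp hm⟩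
  have hlen : l'.length + p = k + 1 := by
    rw [← hl, hl'.length_eq, List.length_append, List.length_replicate, add_comm]
  have h := prod_sub_prod_mem_wordSpan (p := p) (b := b) hl' k hl
  rw [← sub_add_cancel (l.map fun i => ι p F L (b i)).prod]
  refine add_mem h ?_
  rw [List.map_append, List.prod_append, List.map_replicate, List.prod_replicate, ι_pow]
  exact wordSpan_mono (by lia) (ι_mul_mem_wordSpan _ (prod_mem_wordSpan le_rfl))

/-- The span contains `1` and is stable under left multiplication by `L`, hence by `u(L)`. -/
theorem wordSpan_eq_top [Fintype I] (hp : 1 < p) :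
    wordSpan p b (Fintype.card I * (p - 1)) = ⊤ := by
  set k := Fintype.card I * (p - 1) with hk
  have hsucc : wordSpan p b (k + 1) ≤ wordSpan p b k := by
    refine Submodule.span_le.mpr ?_
    rintro _ ⟨l, hl, rfl⟩
    rcases (Nat.le_add_one_iff.mp hl) with h | h
    · exact prod_mem_wordSpan h
    · exact prod_mem_wordSpan_of_le_length hp hk.ge h
  have hmul (a c : RestrictedEnvelopingAlgebra p F L) (hc : c ∈ wordSpan p b k) :
      a * c ∈ wordSpan p b k := by
    induction a using RestrictedEnvelopingAlgebra.induction generalizing c with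
    | algebraMap r => rw [← Algebra.smul_def]; exact Submodule.smul_mem _ r hc
    | ι x => exact hsucc (ι_mul_mem_wordSpan x hc)
    | add a a' h h' => rw [add_mul]; exact add_mem (h c hc) (h' c hc)
    | mul a a' h h' => rw [mul_assoc]; exact h _ (h' c hc)
  refine eq_top_iff.mpr fun a _ => ?_
  rw [← mul_one a]
  exact hmul a 1 (prod_mem_wordSpan (l := []) (Nat.zero_le _))

end FiniteDimensional

instance finiteDimensional [Fact p.Prime] [FiniteDimensional F L] :
    FiniteDimensional F (RestrictedEnvelopingAlgebra p F L) := by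
  refine ⟨?_⟩
  rw [← wordSpan_eq_top (b := Module.finBasis F L) (Fact.out : p.Prime).one_lt]
  exact Submodule.fg_span ((List.finite_length_le _ _).image _)

instance isArtinianRing [Fact p.Prime] [FiniteDimensional F L] :
    IsArtinianRing (RestrictedEnvelopingAlgebra p F L) :=
  IsArtinianRing.of_finite F _

end RestrictedEnvelopingAlgebra

end RestrictedEnvelopingAlgebra

/-! ### From restricted `L`-modules to `u(L)`-modules. -/

section RestrictedModules

variable {p : ℕ} {F L S : Type*} [Field F] [LieRing L] [LieAlgebra F L]
  [RestrictedLieAlgebra p F L] [AddCommGroup S] [Module F S] [LieRingModule L S]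
  [LieModule F L S]

open RestrictedEnvelopingAlgebra in
/-- An `F`-linear map between restricted `L`-modules that commutes with the action of `L`, as a
homomorphism of `u(L)`-modules. -/
noncomputable def UModule.mapOfEquivariant {T : Type*} [AddCommGroup T] [Module F T]
    [LieRingModule L T] [LieModule F L T] [IsRestrictedModule p F L S] [IsRestrictedModule p F L T]
    (f : S →ₗ[F] T) (hf : ∀ (x : L) (s : S), f ⁅x, s⁆ = ⁅x, f s⁆) :
    UModule p F L S →ₗ[RestrictedEnvelopingAlgebra p F L] UModule p F L T where
  toFun := f
  map_add' := map_add f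
  map_smul' a s := by
    refine map_rep_apply (ρ := restrictedRep p F L S) (τ := restrictedRep p F L T) f ?_ a s
    intro x s
    rw [ι_apply, restrictedRep_ι, restrictedRep_ι]
    exact hf x s

instance UModule.isSimpleModule [IsRestrictedModule p F L S] [LieModule.IsIrreducible F L S] :
    IsSimpleModule (RestrictedEnvelopingAlgebra p F L) (UModule p F L S) := by
  have : Nontrivial S := LieModule.nontrivial_of_isIrreducible F L S
  have : Nontrivial (UModule p F L S) := inferInstanceAs (Nontrivial S)
  have : IsSimpleOrder (Submodule (RestrictedEnvelopingAlgebra p F L) (UModule p F L S)) := by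
    refine ⟨fun N => ?_⟩
    let N' : LieSubmodule F L S :=
      { carrier := {s : S | (s : UModule p F L S) ∈ N}
        add_mem' := fun {a b} ha hb => N.add_mem ha hb
        zero_mem' := N.zero_mem
        smul_mem' := fun c s hs => by
          have h : restrictedRep p F L S (algebraMap F _ c) s ∈ N :=
            N.smul_mem (algebraMap F _ c) hs
          rw [AlgHom.commutes, Module.algebraMap_end_apply] at h
          exact h
        lie_mem := fun {x s} hs => by
          have h : restrictedRep p F L S (RestrictedEnvelopingAlgebra.ι p F L x) s ∈ N :=
            N.smul_mem (RestrictedEnvelopingAlgebra.ι p F L x) hs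
          rw [RestrictedEnvelopingAlgebra.ι_apply, restrictedRep_ι] at h
          exact h }
    rcases eq_bot_or_eq_top N' with h | h
    · refine .inl (eq_bot_iff.mpr fun s hs => ?_)
      have hs' : (s : S) ∈ N' := hs
      rw [h] at hs'
      exact hs'
    · refine .inr (eq_top_iff.mpr fun s _ => ?_)
      have hs' : (s : S) ∈ N' := by rw [h]; trivial
      exact hs'
  exact ⟨⟩

instance trivial_isIrreducible : LieModule.IsIrreducible F L (TrivialLieModule F L F) := by
  have : Nontrivial (TrivialLieModule F L F) := inferInstanceAs (Nontrivial F)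
  refine LieModule.IsIrreducible.mk fun N hN => ?_
  obtain ⟨x, hx, hx0⟩ := (Submodule.ne_bot_iff N.toSubmodule).mp
    (LieSubmodule.toSubmodule_eq_bot N |>.not.mpr hN)
  refine eq_top_iff.mpr fun y _ => ?_
  let a : F := x
  let b : F := y
  have hxy : (b * a⁻¹) • x = y := inv_mul_cancel_right₀ (a := b) (b := a) hx0
  rw [← hxy]
  exact N.smul_mem _ hx

end RestrictedModules

/-! ### Extensions of the trivial module defined by derivations. -/

section Cocycles

variable {p : ℕ} {F L S : Type*} [Field F] [LieRing L] [LieAlgebra F L]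
  [AddCommGroup S] [Module F S] [LieRingModule L S] [LieModule F L S]

attribute [local instance] LieRing.ofAssociativeRing

/-- Left and right multiplication by `x` commute, so in characteristic `p` the `p`-th power of their
difference is the difference of their `p`-th powers. -/
theorem ad_pow_char [Fact p.Prime] [CharP F p] {B : Type*} [Ring B] [Algebra F B] (x y : B) :
    ((LieAlgebra.ad F B x) ^ p) y = ⁅x ^ p, y⁆ := by
  rcases subsingleton_or_nontrivial B with hB | hB
  · exact Subsingleton.elim _ _
  have : CharP (Module.End F B) p :=
    charP_of_injective_algebraMap (algebraMap F (Module.End F B)).injective p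
  have h : LieAlgebra.ad F B x = LinearMap.mulLeft F x - LinearMap.mulRight F x := by
    ext z; rfl
  rw [h, sub_pow_char_of_commute p (LinearMap.commute_mulLeft_right x x), LinearMap.pow_mulLeft,
    LinearMap.pow_mulRight]
  rfl

/-- The action of `L` on the extension of the trivial module `F` by `S` defined by a derivation. -/
def cocycleRep (D : LieDerivation F L S) : L →ₗ⁅F⁆ Module.End F (S × F) where
  toFun x := LinearMap.inl F S F ∘ₗ
    ((LieModule.toEnd F L S x).coprod (LinearMap.toSpanSingleton F S (D x)))
  map_add' x y := by ext <;> simp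
  map_smul' c x := by ext <;> simp
  map_lie' {x y} := by
    ext <;> simp [Ring.lie_def]

theorem cocycleRep_apply (D : LieDerivation F L S) (x : L) (v : S × F) :
    cocycleRep D x v = (⁅x, v.1⁆ + v.2 • D x, 0) := rfl

theorem cocycleRep_pow_succ_apply (D : LieDerivation F L S) (x : L) (k : ℕ) (v : S × F) :
    (cocycleRep D x ^ (k + 1)) v =
      (((LieModule.toEnd F L S x) ^ k) (⁅x, v.1⁆ + v.2 • D x), 0) := by
  induction k with
  | zero => simp [cocycleRep_apply]
  | succ k ih =>
    rw [pow_succ', Module.End.mul_apply, ih, cocycleRep_apply, pow_succ' (LieModule.toEnd F L S x)]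
    simp

/-- A derivation with values in a restricted module without invariants is a restricted cocycle. -/
theorem cocycleRep_pMap [Fact p.Prime] [CharP F p] [RestrictedLieAlgebra p F L]
    [IsRestrictedModule p F L S] (hS : ∀ s : S, (∀ x : L, ⁅x, s⁆ = 0) → s = 0)
    (D : LieDerivation F L S) (x : L) :
    cocycleRep D (RestrictedLieAlgebra.pMap p F x) = cocycleRep D x ^ p := by
  -- The defect `ρ(x^[p]) - ρ(x)^p`, for `ρ = cocycleRep D`, commutes with `ρ(L)`, because both
  -- terms have commutator `ρ(ad(x)^p y)` with `ρ(y)`.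
  have hcomm (y : L) :
      ⁅cocycleRep D (RestrictedLieAlgebra.pMap p F x) - cocycleRep D x ^ p, cocycleRep D y⁆ = 0 := by
    have hk (k : ℕ) : cocycleRep D ((LieAlgebra.ad F L x ^ k) y) =
        (LieAlgebra.ad F (Module.End F (S × F)) (cocycleRep D x) ^ k) (cocycleRep D y) := by
      induction k with
      | zero => rfl
      | succ k ih =>
        rw [pow_succ', pow_succ', Module.End.mul_apply, Module.End.mul_apply, ← ih,
          LieAlgebra.ad_apply, LieAlgebra.ad_apply, LieHom.map_lie]
    rw [sub_lie, ← ad_pow_char (F := F), ← hk, ← RestrictedLieAlgebra.ad_pMap, LieAlgebra.ad_apply,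
      LieHom.map_lie, sub_self]
  obtain ⟨k, hk⟩ : ∃ k, p = k + 1 := ⟨p - 1, (Nat.sub_add_cancel (Fact.out : p.Prime).one_le).symm⟩
  have hfst (s : S) : ⁅RestrictedLieAlgebra.pMap p F x, s⁆ =
      ((LieModule.toEnd F L S x) ^ k) ⁅x, s⁆ := by
    have h := LinearMap.congr_fun (IsRestrictedModule.toEnd_pMap (p := p) (F := F) (M := S) x) s
    rw [show (LieModule.toEnd F L S x) ^ p = (LieModule.toEnd F L S x) ^ (k + 1) by rw [hk],
      pow_succ] at h
    exact h
  have hsub (v : S × F) : (cocycleRep D (RestrictedLieAlgebra.pMap p F x) - cocycleRep D x ^ p) v =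
      (v.2 • (D (RestrictedLieAlgebra.pMap p F x) - ((LieModule.toEnd F L S x) ^ k) (D x)), 0) := by
    rw [show cocycleRep D x ^ p = cocycleRep D x ^ (k + 1) by rw [← hk], LinearMap.sub_apply,
      cocycleRep_pow_succ_apply, cocycleRep_apply, hfst]
    simp [smul_sub]
  -- The defect kills `S` and sends `(0, 1)` to `(t, 0)`. Evaluating its commutator with `ρ(y)` at
  -- `(0, 1)` gives `⁅y, t⁆ = 0`, so `t` is invariant.
  have hzero : D (RestrictedLieAlgebra.pMap p F x) - ((LieModule.toEnd F L S x) ^ k) (D x) = 0 := by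
    refine hS _ fun y => ?_
    have h := LinearMap.congr_fun (hcomm y) (0, 1)
    rw [Ring.lie_def, LinearMap.sub_apply, Module.End.mul_apply, Module.End.mul_apply, hsub, hsub,
      cocycleRep_apply, cocycleRep_apply] at h
    rw [lie_sub, ← neg_eq_zero, neg_sub]
    simpa using congrArg Prod.fst h
  refine LinearMap.ext fun v => sub_eq_zero.mp ?_
  rw [← LinearMap.sub_apply, hsub, hzero, smul_zero]
  rfl

end Cocycles

/-! ### Outer derivations and the second Loewy layer. -/

section FirstCohomology

variable {p : ℕ} [Fact p.Prime] {F L S : Type*} [Field F] [CharP F p] [LieRing L] [LieAlgebra F L]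
  [RestrictedLieAlgebra p F L] [AddCommGroup S] [Module F S] [LieRingModule L S]
  [LieModule F L S] [IsRestrictedModule p F L S]

open RestrictedEnvelopingAlgebra in
/-- If an irreducible module without invariants has an outer derivation, then it is a quotient of
the second Loewy layer of the projective cover of the trivial module. -/
theorem exists_surjective_loewyLayer [FiniteDimensional F L] [LieModule.IsIrreducible F L S]
    (hS : ∀ s : S, (∀ x : L, ⁅x, s⁆ = 0) → s = 0) (D : LieDerivation F L S)
    (hD : ∀ s : S, ∃ x : L, D x ≠ ⁅x, s⁆)
    {P : Type*} [AddCommGroup P] [Module (RestrictedEnvelopingAlgebra p F L) P]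
    {π : P →ₗ[RestrictedEnvelopingAlgebra p F L] UModule p F L (TrivialLieModule F L F)}
    (hπ : IsProjectiveCover π) :
    ∃ f : LoewyLayer (RestrictedEnvelopingAlgebra p F L) P 2
      →ₗ[RestrictedEnvelopingAlgebra p F L] UModule p F L S, Function.Surjective f := by
  let ρ : RestrictedEnvelopingAlgebra p F L →ₐ[F] Module.End F (S × F) :=
    lift (cocycleRep D) (cocycleRep_pMap hS D)
  have hρ (x : L) (v : S × F) : ρ (ι p F L x) v = (⁅x, v.1⁆ + v.2 • D x, 0) := by
    rw [lift_ι, cocycleRep_apply]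
  let _ : Module (RestrictedEnvelopingAlgebra p F L) (S × F) := Module.compHom _ ρ.toRingHom
  have smul_def (a : RestrictedEnvelopingAlgebra p F L) (v : S × F) : a • v = ρ a v := rfl
  let q : (S × F) →ₗ[RestrictedEnvelopingAlgebra p F L] UModule p F L (TrivialLieModule F L F) :=
    { toFun := fun v => (v.2 : F)
      map_add' := fun _ _ => rfl
      map_smul' := fun a v => by
        refine map_rep_apply (ρ := ρ) (τ := restrictedRep p F L (TrivialLieModule F L F))
          (LinearMap.snd F S F : (S × F) →ₗ[F] TrivialLieModule F L F) (fun x v => ?_) a v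
        rw [hρ, ι_apply, restrictedRep_ι]
        exact (LieModule.IsTrivial.trivial (M := TrivialLieModule F L F) x v.2).symm }
  let i : UModule p F L S →ₗ[RestrictedEnvelopingAlgebra p F L] (S × F) :=
    { toFun := fun s => ((s : S), (0 : F))
      map_add' := fun s t => (LinearMap.inl F S F).map_add s t
      map_smul' := fun a s => by
        refine map_rep_apply (ρ := restrictedRep p F L S) (τ := ρ)
          (LinearMap.inl F S F) (fun x v => ?_) a s
        rw [hρ, ι_apply, restrictedRep_ι]
        simp }
  have hi : Function.Injective i := fun s t h => congrArg Prod.fst h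
  have hrange : LinearMap.range i = LinearMap.ker q := by
    ext v
    constructor
    · rintro ⟨s, rfl⟩; rfl
    · intro h
      exact ⟨v.1, Prod.ext rfl (show (0 : F) = v.2 from h.symm)⟩
  refine hπ.exists_surjective q (fun c => ⟨(0, c), rfl⟩)
    (LinearEquiv.ofInjective i hi ≪≫ₗ LinearEquiv.ofEq _ _ hrange) ?_
  rintro ⟨N, hN⟩
  obtain ⟨v, hv, w, hw, hvw⟩ := Submodule.mem_sup.mp
    (show ((0, 1) : S × F) ∈ N ⊔ LinearMap.ker q by rw [hN.sup_eq_top]; trivial)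
  have hw2 : w.2 = 0 := hw
  have hv2 : v.2 = 1 := by simpa [hw2] using congrArg Prod.snd hvw
  -- In a complement `N`, the vector `v = (s, 1)` satisfies `x • v ∈ N ⊓ ker q = 0` for all `x`, so
  -- `D` would be inner, given by `-s`.
  obtain ⟨x, hx⟩ := hD (-v.1)
  have hmem : ι p F L x • v ∈ N ⊓ LinearMap.ker q :=
    ⟨N.smul_mem _ hv, congrArg Prod.snd (hρ x v)⟩
  rw [hN.inf_eq_bot, Submodule.mem_bot, smul_def, hρ, hv2, one_smul] at hmem
  refine hx ?_
  rw [lie_neg]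
  exact eq_neg_of_add_eq_zero_right (congrArg Prod.fst hmem)

end FirstCohomology

/-! ### Chief factors and the derivation of a splitting. -/

section ChiefFactors

variable {F L : Type*} [Field F] [LieRing L] [LieAlgebra F L]

theorem lieQuotMk_surjective (I : LieIdeal F L) : Function.Surjective (lieQuotMk I) :=
  Submodule.Quotient.mk_surjective _

theorem lieQuotMk_eq_zero {I : LieIdeal F L} {x : L} : lieQuotMk I x = 0 ↔ x ∈ I :=
  Submodule.Quotient.mk_eq_zero I.toSubmodule

theorem lieQuotFactor_lieQuotMk {I J : LieIdeal F L} (h : I ≤ J) (x : L) :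
    lieQuotFactor h (lieQuotMk I x) = lieQuotMk J x := rfl

theorem mem_map_lieQuotMk {I J : LieIdeal F L} {y : L ⧸ I} :
    y ∈ LieIdeal.map (lieQuotMk I) J ↔ ∃ x ∈ J, lieQuotMk I x = y := by
  rw [← LieSubmodule.mem_toSubmodule, LieIdeal.coe_map_of_surjective (lieQuotMk_surjective I)]
  rfl

theorem mem_map_lieQuotMk_iff {I J : LieIdeal F L} (h : I ≤ J) {y : L ⧸ I} :
    y ∈ LieIdeal.map (lieQuotMk I) J ↔ lieQuotFactor h y = 0 := by
  obtain ⟨x, rfl⟩ := lieQuotMk_surjective I y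
  rw [lieQuotFactor_lieQuotMk, lieQuotMk_eq_zero, mem_map_lieQuotMk]
  refine ⟨?_, fun hx => ⟨x, hx, rfl⟩⟩
  rintro ⟨z, hz, hzx⟩
  have hxz : x - z ∈ I := by rw [← lieQuotMk_eq_zero, map_sub, hzx, sub_self]
  simpa using J.add_mem (h hxz) hz

/-- The inclusion of `J / I` into `L / I`. -/
def lieFactorIncl (I J : LieIdeal F L) : LieFactor I J →ₗ[F] L ⧸ I :=
  Submodule.mapQ (LieSubmodule.comap (LieSubmodule.incl J) I).toSubmodule I.toSubmodule
    J.toSubmodule.subtype le_rfl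

theorem lieFactorIncl_injective (I J : LieIdeal F L) : Function.Injective (lieFactorIncl I J) := by
  refine (injective_iff_map_eq_zero _).mpr fun s hs => ?_
  obtain ⟨x, rfl⟩ := Submodule.Quotient.mk_surjective _ s
  exact (Submodule.Quotient.mk_eq_zero _).mpr (lieQuotMk_eq_zero.mp hs)

theorem lieFactorIncl_lie (I J : LieIdeal F L) (x : L) (s : LieFactor I J) :
    lieFactorIncl I J ⁅x, s⁆ = ⁅lieQuotMk I x, lieFactorIncl I J s⁆ := by
  obtain ⟨y, rfl⟩ := Submodule.Quotient.mk_surjective _ s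
  rfl

theorem mem_range_lieFactorIncl {I J : LieIdeal F L} {y : L ⧸ I} :
    y ∈ LinearMap.range (lieFactorIncl I J) ↔ y ∈ LieIdeal.map (lieQuotMk I) J := by
  rw [mem_map_lieQuotMk]
  constructor
  · rintro ⟨s, rfl⟩
    obtain ⟨x, rfl⟩ := Submodule.Quotient.mk_surjective _ s
    exact ⟨x, x.2, rfl⟩
  · rintro ⟨x, hx, rfl⟩
    exact ⟨LieSubmodule.Quotient.mk ⟨x, hx⟩, rfl⟩

/-- `L` acts on `J / I` through `L / I`, so submodules of `J / I` are ideals of `L / I` contained in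
the atom. -/
theorem lieFactor_isIrreducible {I J : LieIdeal F L}
    (h : IsAtom (LieIdeal.map (lieQuotMk I) J)) : LieModule.IsIrreducible F L (LieFactor I J) := by
  have hnt : Nontrivial (LieFactor I J) := by
    by_contra hcon
    have := not_nontrivial_iff_subsingleton.mp hcon
    refine h.1 (eq_bot_iff.mpr fun y hy => ?_)
    obtain ⟨s, rfl⟩ := mem_range_lieFactorIncl.mpr hy
    rw [Subsingleton.elim s 0, map_zero]
    exact zero_mem _
  refine LieModule.IsIrreducible.mk fun N hN => ?_
  let K : LieIdeal F (L ⧸ I) :=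
    { N.toSubmodule.map (lieFactorIncl I J) with
      lie_mem := by
        rintro y _ ⟨s, hs, rfl⟩
        obtain ⟨x, rfl⟩ := lieQuotMk_surjective I y
        exact ⟨⁅x, s⁆, N.lie_mem hs, lieFactorIncl_lie I J x s⟩ }
  have hK {s : LieFactor I J} : lieFactorIncl I J s ∈ K ↔ s ∈ N := by
    refine ⟨?_, fun hs => ⟨s, hs, rfl⟩⟩
    rintro ⟨t, ht, hts⟩
    rwa [← lieFactorIncl_injective I J hts]
  have hle : K ≤ LieIdeal.map (lieQuotMk I) J := by
    rintro _ ⟨s, -, rfl⟩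
    exact mem_range_lieFactorIncl.mp ⟨s, rfl⟩
  rcases h.le_iff.mp hle with hbot | htop
  · refine absurd (eq_bot_iff.mpr fun s hs => ?_) hN
    have hs' := hK.mpr hs
    rw [hbot] at hs'
    exact (lieFactorIncl_injective I J) (((LieSubmodule.mem_bot _).mp hs').trans (map_zero _).symm)
  · refine eq_top_iff.mpr fun s _ => hK.mp ?_
    rw [htop]
    exact mem_range_lieFactorIncl.mp ⟨s, rfl⟩

/-- Minimal ideals of a solvable Lie algebra are abelian. -/
theorem LieIdeal.lie_self_eq_bot_of_isAtom [LieAlgebra.IsSolvable L] {K : LieIdeal F L}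
    (hK : IsAtom K) : ⁅K, K⁆ = ⊥ := by
  rcases hK.le_iff.mp (LieSubmodule.lie_le_right K K) with h | h
  · exact h
  -- If `K` were perfect, its derived series would be constant, yet it lies below that of `L`, which
  -- reaches zero.
  · have hk (k : ℕ) : LieAlgebra.derivedSeriesOfIdeal F L k K = K := by
      induction k with
      | zero => rfl
      | succ k ih => rw [LieAlgebra.derivedSeriesOfIdeal_succ, ih, h]
    obtain ⟨k, hk'⟩ := LieAlgebra.IsSolvable.solvable F L
    refine absurd (eq_bot_iff.mpr ?_) hK.1
    rw [← hk', ← hk k]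
    exact LieAlgebra.derivedSeriesOfIdeal_mono le_top k

theorem lie_eq_zero_of_mem_map_lieQuotMk [LieAlgebra.IsSolvable L] {I J : LieIdeal F L}
    (h : IsAtom (LieIdeal.map (lieQuotMk I) J)) {y z : L ⧸ I}
    (hy : y ∈ LieIdeal.map (lieQuotMk I) J) (hz : z ∈ LieIdeal.map (lieQuotMk I) J) :
    ⁅y, z⁆ = 0 := by
  have : LieAlgebra.IsSolvable (L ⧸ I) :=
    (lieQuotMk_surjective I).lieAlgebra_isSolvable
  have hm := LieSubmodule.lie_mem_lie hy hz
  rwa [LieIdeal.lie_self_eq_bot_of_isAtom h, LieSubmodule.mem_bot] at hm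

/-- The projection along the complement given by a splitting is an outer derivation. -/
theorem exists_outer_lieDerivation [LieAlgebra.IsSolvable L] {I J : LieIdeal F L} (hIJ : I ≤ J)
    (h : IsAtom (LieIdeal.map (lieQuotMk I) J)) (hsplit : IsSplitFactor hIJ) :
    ∃ D : LieDerivation F L (LieFactor I J), ∀ s, ∃ x, D x ≠ ⁅x, s⁆ := by
  obtain ⟨σ, hσ⟩ := hsplit
  let d : L →ₗ[F] L ⧸ I := (lieQuotMk I : L →ₗ[F] L ⧸ I) - (σ.comp (lieQuotMk J) : L →ₗ[F] L ⧸ I)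
  have hd (x : L) : d x = lieQuotMk I x - σ (lieQuotMk J x) := rfl
  have hdJ (x : L) : d x ∈ LieIdeal.map (lieQuotMk I) J := by
    rw [mem_map_lieQuotMk_iff hIJ, hd, map_sub, hσ, lieQuotFactor_lieQuotMk, sub_self]
  let e := LinearEquiv.ofInjective (lieFactorIncl I J) (lieFactorIncl_injective I J)
  let D₀ : L →ₗ[F] LieFactor I J := e.symm.toLinearMap ∘ₗ
    d.codRestrict (LinearMap.range (lieFactorIncl I J)) fun x => mem_range_lieFactorIncl.mpr (hdJ x)
  have hD₀ (x : L) : lieFactorIncl I J (D₀ x) = d x :=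
    congrArg Subtype.val (e.apply_symm_apply ⟨d x, mem_range_lieFactorIncl.mpr (hdJ x)⟩)
  let D : LieDerivation F L (LieFactor I J) :=
    { D₀ with
      leibniz' := fun x y => by
        refine lieFactorIncl_injective I J ?_
        change lieFactorIncl I J (D₀ ⁅x, y⁆) = lieFactorIncl I J (⁅x, D₀ y⁆ - ⁅y, D₀ x⁆)
        -- For classes `a`, `b` of `x`, `y` modulo `I`, and `σ` applied through `L / J`, the defect
        -- in the Leibniz rule is exactly `⁅a - σa, b - σb⁆`, a bracket inside the abelian factor.
        have h0 := lie_eq_zero_of_mem_map_lieQuotMk h (hdJ x) (hdJ y)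
        rw [map_sub, lieFactorIncl_lie, lieFactorIncl_lie, hD₀, hD₀, hD₀]
        rw [hd, hd, sub_lie, lie_sub, lie_sub] at h0
        rw [hd, hd, hd, LieHom.map_lie, LieHom.map_lie, LieHom.map_lie, lie_sub, lie_sub,
          ← lie_skew (lieQuotMk I y) (lieQuotMk I x), ← lie_skew (lieQuotMk I y)]
        rw [← sub_eq_zero, ← neg_eq_zero, ← h0]
        abel }
  refine ⟨D, fun s => ?_⟩
  obtain ⟨y, hy, hy0⟩ : ∃ y ∈ LieIdeal.map (lieQuotMk I) J, y ≠ 0 :=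
    (Submodule.ne_bot_iff _).mp (LieSubmodule.toSubmodule_eq_bot _ |>.not.mpr h.1)
  obtain ⟨x, hx, rfl⟩ := mem_map_lieQuotMk.mp hy
  -- For `x ∈ J` outside `I`, `d x` is the nonzero class of `x`, whereas `⁅x, s⁆ = 0` since `J / I`
  -- is abelian.
  refine ⟨x, fun hcon => hy0 ?_⟩
  have h1 : d x = lieFactorIncl I J ⁅x, s⁆ := (hD₀ x).symm.trans (congrArg _ hcon)
  rwa [lieFactorIncl_lie, lie_eq_zero_of_mem_map_lieQuotMk h hy
    (mem_range_lieFactorIncl.mp ⟨s, rfl⟩), hd, lieQuotMk_eq_zero.mpr hx, map_zero, sub_zero] at h1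

/-- The invariants form a submodule, and it is proper because the action is non-trivial. -/
theorem LieModule.IsIrreducible.eq_zero_of_forall_lie_eq_zero {S : Type*} [AddCommGroup S]
    [Module F S] [LieRingModule L S] [LieModule F L S] [LieModule.IsIrreducible F L S]
    (h : ¬ LieModule.IsTrivial L S) (s : S) (hs : ∀ x : L, ⁅x, s⁆ = 0) : s = 0 := by
  rcases eq_bot_or_eq_top (LieModule.maxTrivSubmodule F L S) with hbot | htop
  · have hs' : s ∈ LieModule.maxTrivSubmodule F L S := hs
    rwa [hbot, LieSubmodule.mem_bot] at hs'
  · exact absurd ((LieModule.isTrivial_iff_max_triv_eq_top F L S).mpr htop) h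

theorem UModule.exists_surjective_of_isTrivial {p : ℕ} [Fact p.Prime] [RestrictedLieAlgebra p F L]
    {S : Type*} [AddCommGroup S] [Module F S] [LieRingModule L S] [LieModule F L S]
    [IsRestrictedModule p F L S] [LieModule.IsIrreducible F L S] [LieModule.IsTrivial L S] :
    ∃ f : UModule p F L (TrivialLieModule F L F) →ₗ[RestrictedEnvelopingAlgebra p F L]
      UModule p F L S, Function.Surjective f := by
  have := LieModule.nontrivial_of_isIrreducible F L S
  obtain ⟨s, hs⟩ := exists_ne (0 : S)
  let f₀ : TrivialLieModule F L F →ₗ[F] S := LinearMap.toSpanSingleton F S s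
  let f := UModule.mapOfEquivariant (p := p) (L := L) f₀ fun x c => by
    rw [LieModule.IsTrivial.trivial, LieModule.IsTrivial.trivial, map_zero]
  have hf : f ≠ 0 := fun h0 => hs ((one_smul F s).symm.trans (LinearMap.congr_fun h0 (1 : F)))
  exact ⟨f, LinearMap.surjective_of_ne_zero hf⟩

end ChiefFactors

theorem corollary5p2 {p : ℕ} [Fact p.Prime] {F : Type*} [Field F] [CharP F p]
    {L : Type*} [LieRing L] [LieAlgebra F L] [FiniteDimensional F L] [RestrictedLieAlgebra p F L]
    [LieAlgebra.IsSolvable L]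
    {P : Type*} [AddCommGroup P] [Module (RestrictedEnvelopingAlgebra p F L) P]
    (π : P →ₗ[RestrictedEnvelopingAlgebra p F L] UModule p F L (TrivialLieModule F L F))
    (hπ : IsProjectiveCover π)
    {n : ℕ} (I : Fin (n + 1) → LieIdeal F L) (hI : IsChiefSeries I) (j : Fin n)
    (hsplit : IsSplitFactor (hI.le j)) :
    (¬ LieModule.IsTrivial L (LieFactor (I j.castSucc) (I j.succ)) →
      IsDirectSummand (RestrictedEnvelopingAlgebra p F L)
        (LoewyLayer (RestrictedEnvelopingAlgebra p F L) P 2)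
        (UModule p F L (LieFactor (I j.castSucc) (I j.succ)))) ∧
    IsCompositionFactor (RestrictedEnvelopingAlgebra p F L) P
      (UModule p F L (LieFactor (I j.castSucc) (I j.succ))) := by
  have := lieFactor_isIrreducible (hI.minimal j)
  have hfin : Module.Finite (RestrictedEnvelopingAlgebra p F L) P := hπ.finite
  have key (h : ¬ LieModule.IsTrivial L (LieFactor (I j.castSucc) (I j.succ))) :
      ∃ f : LoewyLayer (RestrictedEnvelopingAlgebra p F L) P 2 →ₗ[RestrictedEnvelopingAlgebra p F L]
        UModule p F L (LieFactor (I j.castSucc) (I j.succ)), Function.Surjective f := by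
    obtain ⟨D, hD⟩ := exists_outer_lieDerivation (hI.le j) (hI.minimal j) hsplit
    exact exists_surjective_loewyLayer
      (LieModule.IsIrreducible.eq_zero_of_forall_lie_eq_zero (F := F) h) D hD hπ
  refine ⟨fun h => ?_, ?_⟩
  · obtain ⟨f, hf⟩ := key h
    exact isDirectSummand_of_surjective f hf
  · by_cases h : LieModule.IsTrivial L (LieFactor (I j.castSucc) (I j.succ))
    · obtain ⟨f, hf⟩ := UModule.exists_surjective_of_isTrivial (p := p) (F := F) (L := L)
        (S := LieFactor (I j.castSucc) (I j.succ))
      -- A trivial factor is already a quotient of `P`, through `π`.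
      refine isCompositionFactor_of_surjective (N := ⊤) (f ∘ₗ π ∘ₗ Submodule.subtype ⊤)
        (hf.comp (hπ.surjective.comp fun x => ⟨⟨x, trivial⟩, rfl⟩))
    · obtain ⟨f, hf⟩ := key h
      -- The submodule used here is `Jac P`, mapped onto `S` through the second layer.
      exact isCompositionFactor_of_surjective (f ∘ₗ Submodule.mkQ _)
        (hf.comp (Submodule.mkQ_surjective _))
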